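/- Let $\mathbb K=\mathbb R$ or $\mathbb C$. For a locally convex Hausdorff space $E$ over $\mathbb K$ let $E'$ be its topological dual, let $E_b'$ be $E'$ with the topology of uniform convergence on the bounded subsets of $E$, and let $\tau_{c}(E',E)$ be the topology on $E'$ of uniform convergence on the compact subsets of $E$. A topological isomorphism is a linear homeomorphism. Let $(X,\tau)$ be a locally convex Hausdorff space over $\mathbb K$ with a complete barrelled predual $(Y,\varphi)$, i.e. $Y$ is a complete barrelled locally convex Hausdorff space over $\mathbb K$ and $\varphi\colon (X,\tau)\to Y_b'$ is a topological isomorphism. Let $\mathcal B$ be the family of $\tau$-bounded subsets of $X$. Let $\sigma_\varphi(X,Y)$ and $\tau_{c,\varphi}(X,Y)$ be the topologies on $X$ given by the seminorms $x\mapsto \sup_{y\in N}|\varphi(x)(y)|$, where $N$ ranges over the finite, respectively the compact, subsets of $Y$. Let $\widetilde\gamma_\varphi$ be the finest locally convex Hausdorff topology on $X$ which coincides with $\sigma_\varphi(X,Y)$ on every $\tau$-bounded set. Let $X_{\mathcal B,\sigma_\varphi(X,Y)}'$ be the space of all linear functionals on $X$ whose restriction to every $B\in\mathcal B$ is $\sigma_\varphi(X,Y)$-continuous,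 equipped with the topology $\beta$ of uniform convergence on the members of $\mathcal B$. Let $\mathcal J_Y\colon Y\to (Y',\tau_c(Y',Y))_b'$, $y\mapsto[y'\mapsto y'(y)]$. Then the following assertions hold. (a) $\sigma_\varphi(X,Y)$ is a locally convex Hausdorff topology for which $(X,\tau)$ satisfies (BBC) and (CNC): every $\tau$-bounded subset of $X$ is contained in an absolutely convex, $\tau$-bounded, $\sigma_\varphi(X,Y)$-compact set, and $\tau$ has a $0$-neighbourhood basis of absolutely convex $\sigma_\varphi(X,Y)$-closed sets. Moreover $\widetilde\gamma_\varphi=\tau_{c,\varphi}(X,Y)$, and a subset of $X$ is $\tau$-bounded if and only if it is $\widetilde\gamma_\varphi$-bounded (this is condition $(\mathrm B\tau\mathrm B\widetilde\gamma_\varphi)$). (b) The three maps $$\kappa_\varphi\colon (Y',\tau_c(Y',Y))_b'\to (X,\widetilde\gamma_\varphi)_b',\quad y''\mapsto y''\circ\varphi,$$ $$\kappa_\varphi\circ\mathcal J_Y\colon Y\to (X,\widetilde\gamma_\varphi)_b',$$ $$\mathcal I_\varphi\colon (X,\tau)\to((X,\widetilde\gamma_\varphi)_b')_b',\quad x\mapsto[x'\mapsto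 x'(x)],$$ are well-defined topological isomorphisms. The dual map $(\kappa_\varphi\circ\mathcal J_Y)^t\colon ((X,\widetilde\gamma_\varphi)_b')'\to Y'$, $x''\mapsto x''\circ\kappa_\varphi\circ\mathcal J_Y$, satisfies $(\kappa_\varphi\circ\mathcal J_Y)^t=\varphi\circ\mathcal I_\varphi^{-1}$. Furthermore $(X,\widetilde\gamma_\varphi)_b'=(X_{\mathcal B,\sigma_\varphi(X,Y)}',\beta)$, with the same functionals and the same topology. (c) For every map $x'\colon X\to\mathbb K$ the following are equivalent: $x'\in(X,\widetilde\gamma_\varphi)'$; $x'\in(X,\sigma_\varphi(X,Y))'$; there is $y\in Y$ with $x'=\varphi(\cdot)(y)$. In this case $y$ is unique. -/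

import Mathlib

open Topology Bornology
open scoped ComplexOrder CompactConvergenceCLM

noncomputable section

/-! Over `𝕜 = ℝ` or `ℂ`, convexity and local convexity are taken with respect to the order
`0 ≤ a ↔ a is a nonnegative real` on `𝕜`, so they are the usual (real) notions. The order on
topologies is Mathlib's one: `t ≤ s` means that `t` is finer than `s`. -/

namespace LCDual

/-! ### A vector space with another topology -/

section Copy

variable {X : Type*} (t : TopologicalSpace X)

instance instAddCommGroupWithTopology [AddCommGroup X] : AddCommGroup (WithTopology X t) :=
  (WithTopology.equiv X t).addCommGroup

instance instModuleWithTopology (𝕜 : Type*) [Semiring 𝕜] [AddCommGroup X] [Module 𝕜 X] :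
    Module 𝕜 (WithTopology X t) :=
  (WithTopology.equiv X t).module 𝕜

end Copy

section General

variable (𝕜 : Type*) [RCLike 𝕜] {X : Type*} [AddCommGroup X] [Module 𝕜 X]

/-- `t` is a locally convex Hausdorff (vector space) topology on the `𝕜`-vector space `X`. -/
structure IsLCHausdorff (t : TopologicalSpace X) : Prop where
  isTopologicalAddGroup : @IsTopologicalAddGroup X t _
  continuousSMul : @ContinuousSMul 𝕜 X _ _ t
  locallyConvexSpace : @LocallyConvexSpace 𝕜 X _ _ _ _ t
  t2Space : @T2Space X t

/-- The subset `B` of `X` is bounded for the topology `t`. -/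
def IsBddFor (t : TopologicalSpace X) (B : Set X) : Prop :=
  @IsVonNBounded 𝕜 X _ _ _ t B

/-- Condition (BBC) of `(X, τ)` for the locally convex Hausdorff topology `τ'`. -/
def BBC (τ τ' : TopologicalSpace X) : Prop :=
  IsLCHausdorff 𝕜 τ' ∧ ∀ B : Set X, IsBddFor 𝕜 τ B →
    ∃ K : Set X, B ⊆ K ∧ AbsConvex 𝕜 K ∧ IsBddFor 𝕜 τ K ∧ @IsCompact X τ' K

/-- Condition (CNC) of `(X, τ)` for the locally convex Hausdorff topology `τ'`. -/
def CNC (τ τ' : TopologicalSpace X) : Prop :=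
  IsLCHausdorff 𝕜 τ' ∧ ∃ U₀ : Set (Set X),
    (∀ U ∈ U₀, AbsConvex 𝕜 U ∧ IsClosed[τ'] U) ∧
    (@nhds X τ 0).HasBasis (fun U : Set X => U ∈ U₀) id

/-- The topologies `t` and `τ'` coincide on every `τ`-bounded set. -/
def CoincideOnBdd (τ τ' t : TopologicalSpace X) : Prop :=
  ∀ B : Set X, IsBddFor 𝕜 τ B →
    t.induced (Subtype.val : B → X) = τ'.induced (Subtype.val : B → X)

/-- The generalised mixed topology of `τ` and `τ'`: the finest locally convex Hausdorff topology
which coincides with `τ'` on `τ`-bounded sets (see `isLeast_mixedTopology`). -/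
def mixedTopology (τ τ' : TopologicalSpace X) : TopologicalSpace X :=
  sInf {t | IsLCHausdorff 𝕜 t ∧ CoincideOnBdd 𝕜 τ τ' t}

theorem isLeast_mixedTopology (τ : TopologicalSpace X) {τ' : TopologicalSpace X}
    (h : IsLCHausdorff 𝕜 τ') :
    IsLeast {t | IsLCHausdorff 𝕜 t ∧ CoincideOnBdd 𝕜 τ τ' t} (mixedTopology 𝕜 τ τ') := by
  have hmem : τ' ∈ {t | IsLCHausdorff 𝕜 t ∧ CoincideOnBdd 𝕜 τ τ' t} :=
    ⟨h, fun _ _ => rfl⟩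
  refine ⟨⟨⟨?_, ?_, ?_, ?_⟩, ?_⟩, fun t ht => sInf_le ht⟩
  · exact topologicalAddGroup_sInf fun t ht => ht.1.isTopologicalAddGroup
  · exact continuousSMul_sInf fun t ht => ht.1.continuousSMul
  · exact LocallyConvexSpace.sInf fun t ht => ht.1.locallyConvexSpace
  · exact @T2Space.of_injective_continuous X X (mixedTopology 𝕜 τ τ') τ' h.t2Space id
      Function.injective_id (continuous_id_iff_le.2 (sInf_le hmem))
  · intro B hB
    refine le_antisymm (induced_mono (sInf_le hmem)) ?_
    rw [mixedTopology, sInf_eq_iInf, induced_iInf]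
    refine le_iInf fun t => ?_
    rw [induced_iInf]
    exact le_iInf fun ht => (ht.2 B hB).ge

/-- The `τ`-bounded sets and the `γ`-bounded sets are the same. -/
def SameBdd (τ γ : TopologicalSpace X) : Prop :=
  ∀ B : Set X, IsBddFor 𝕜 τ B ↔ IsBddFor 𝕜 γ B

/-- The space of all linear functionals on `X` whose restrictions to `τ`-bounded sets are
`τ'`-continuous. -/
def bddContDual (τ τ' : TopologicalSpace X) : Submodule 𝕜 (Module.Dual 𝕜 X) where
  carrier := {f | ∀ B : Set X, IsBddFor 𝕜 τ B → @ContinuousOn X 𝕜 τ' _ f B}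
  add_mem' hf hg B hB := by
    let := τ'
    exact (hf B hB).add (hg B hB)
  zero_mem' B _ := by
    let := τ'
    exact continuousOn_const
  smul_mem' c f hf B hB := by
    let := τ'
    exact (hf B hB).const_smul c

/-- The topology of uniform convergence on `τ`-bounded sets on `bddContDual 𝕜 τ τ'`. -/
instance instTopologicalSpaceBddContDual (τ τ' : TopologicalSpace X) :
    TopologicalSpace (bddContDual 𝕜 τ τ') :=
  (UniformOnFun.topologicalSpace X 𝕜 {B | IsBddFor 𝕜 τ B}).induced
    fun f => UniformOnFun.ofFun {B | IsBddFor 𝕜 τ B} (f : Module.Dual 𝕜 X)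

end General

section Predual

variable {𝕜 : Type*} [RCLike 𝕜] {X Y : Type*} [AddCommGroup Y] [Module 𝕜 Y] [TopologicalSpace Y]

/-- For `φ : X → Y'` and a family `𝔖` of subsets of `Y`: the topology on `X` of uniform
convergence of `y ↦ φ x y` on the members of `𝔖`. -/
def pairingTopology (φ : X → StrongDual 𝕜 Y) (𝔖 : Set (Set Y)) : TopologicalSpace X :=
  (UniformConvergenceCLM.instTopologicalSpace (RingHom.id 𝕜) 𝕜 𝔖).induced
    fun x => UniformConvergenceCLM.ofFun (RingHom.id 𝕜) 𝕜 𝔖 (φ x)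

/-- `σ_φ(X, Y)`, given by the seminorms `x ↦ sup_{y ∈ N} |φ x y|`, `N ⊆ Y` finite. -/
def sigmaTopology (φ : X → StrongDual 𝕜 Y) : TopologicalSpace X :=
  pairingTopology φ {N | N.Finite}

/-- `τ_{c,φ}(X, Y)`, given by the seminorms `x ↦ sup_{y ∈ N} |φ x y|`, `N ⊆ Y` compact. -/
def compactTopology (φ : X → StrongDual 𝕜 Y) : TopologicalSpace X :=
  pairingTopology φ {N | IsCompact N}

/-- The generalised mixed topology of `τ` and `σ_φ(X, Y)`. -/
def mixedTopologyOf [AddCommGroup X] [Module 𝕜 X] (τ : TopologicalSpace X)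
    (φ : X → StrongDual 𝕜 Y) : TopologicalSpace X :=
  mixedTopology 𝕜 τ (sigmaTopology φ)

variable (𝕜 Y) in
/-- The evaluation map `J_Y : Y → (Y', τ_c(Y', Y))'`, `y ↦ [y' ↦ y' y]`. -/
def evalCompact : Y → StrongDual 𝕜 (Y →L_c[𝕜] 𝕜) := fun y =>
  { toFun := fun y' => y' y
    map_add' := fun _ _ => rfl
    map_smul' := fun _ _ => rfl
    cont := continuous_eval_const y }

end Predual

end LCDual

end

open LCDual

/-! For a continuous seminorm `p` on `Y` let `dualBall φ p` be the polar in `X` of its unit ball.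
Since `Y` is barrelled, the `τ`-bounded sets are exactly the subsets of such polars. The polars are
`σ_φ(X, Y)`-compact by Alaoglu's theorem, and `τ_{c,φ}(X, Y)` agrees with `σ_φ(X, Y)` on them by
equicontinuity. By Grothendieck's completeness theorem, a linear functional that is
`σ_φ(X, Y)`-continuous on every polar is the evaluation at a point of `Y`: this is where the
completeness of `Y` enters, and it identifies all the duals in question with `Y`.

To compare `τ_{c,φ}(X, Y)` with a locally convex topology `t ≤ σ_φ(X, Y)` that coincides with
`σ_φ(X, Y)` on the polars, exchange the roles of `X` and `Y`. The polars in `X` are `t`-compact, so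
the topology on `Y` of uniform convergence on the `t`-compact subsets of `X` is finer than the
original one. The polar in `Y` of a `t`-neighbourhood of zero is weakly compact by Alaoglu's
theorem, hence compact for this finer topology by equicontinuity, hence compact in `Y`. So
`τ_{c,φ}(X, Y)` is finer than `t`. -/

noncomputable section

namespace LCDual

section HahnBanach

variable {𝕜 E : Type*} [RCLike 𝕜] [AddCommGroup E] [Module 𝕜 E]

theorem exists_dual_le_seminorm_apply_eq (p : Seminorm 𝕜 E) (x : E) :
    ∃ f : Module.Dual 𝕜 E, (∀ z, ‖f z‖ ≤ p z) ∧ ‖f x‖ = p x := by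
  rcases eq_or_ne x 0 with rfl | hx
  · exact ⟨0, fun z => by simp, by simp⟩
  let e := LinearEquiv.toSpanNonzeroSingleton 𝕜 E x hx
  have he : ∀ c, (e c : E) = c • x := fun _ => rfl
  obtain ⟨f, hfe, hfp⟩ := Module.Dual.exists_extension_of_le_seminorm (𝕜 ∙ x)
    ((p x : 𝕜) • (e.symm : (𝕜 ∙ x) →ₗ[𝕜] 𝕜)) (p := p) fun z => by
      obtain ⟨c, rfl⟩ := e.surjective z
      simp [he, map_smul_eq_mul, norm_smul, mul_comm, abs_of_nonneg (apply_nonneg p x)]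
  refine ⟨f, hfp, ?_⟩
  have hfx := hfe (e 1)
  rw [he, one_smul] at hfx
  simp [hfx]

theorem exists_norm_sub_sum_le_seminorm {ι : Type*} [Fintype ι] (p : Seminorm 𝕜 E)
    (f : Module.Dual 𝕜 E) (L : ι → Module.Dual 𝕜 E)
    (h : ∀ x, (∀ i, L i x = 0) → ‖f x‖ ≤ p x) :
    ∃ c : ι → 𝕜, ∀ x, ‖f x - ∑ i, c i * L i x‖ ≤ p x := by
  obtain ⟨g, hgf, hgp⟩ := Module.Dual.exists_extension_of_le_seminorm (⨅ i, LinearMap.ker (L i))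
    (f.domRestrict _) (p := p) fun x =>
      h x (by simpa only [Submodule.mem_iInf, LinearMap.mem_ker] using x.2)
  have hspan : f - g ∈ Submodule.span 𝕜 (Set.range L) := mem_span_of_iInf_ker_le_ker fun x hx => by
    simpa [sub_eq_zero] using (hgf ⟨x, hx⟩).symm
  obtain ⟨c, hc⟩ := (Submodule.mem_span_range_iff_exists_fun 𝕜).1 hspan
  refine ⟨c, fun x => ?_⟩
  have hcx : ∑ i, c i * L i x = f x - g x := by simpa using DFunLike.congr_fun hc x
  simpa [hcx] using hgp x

variable [Module ℝ E] [IsScalarTower ℝ 𝕜 E]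

open scoped Pointwise in
theorem exists_mem_smul_of_mem_span {K : Set E} (hbal : Balanced 𝕜 K) (hconv : Convex ℝ K)
    (hne : K.Nonempty) {x : E} (hx : x ∈ Submodule.span 𝕜 K) : ∃ r : ℝ, 0 < r ∧ x ∈ r • K := by
  induction hx using Submodule.span_induction with
  | mem x hx => exact ⟨1, one_pos, by simpa using hx⟩
  | zero => exact ⟨1, one_pos, by simpa using hbal.zero_mem hne⟩
  | add x y _ _ hx hy =>
    obtain ⟨r, hr, hx⟩ := hx
    obtain ⟨s, hs, hy⟩ := hy
    exact ⟨r + s, add_pos hr hs, hconv.add_smul hr.le hs.le ▸ Set.add_mem_add hx hy⟩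
  | smul c x _ hx =>
    obtain ⟨r, hr, z, hz, rfl⟩ := hx
    have hc : ‖c‖ ≤ ‖‖c‖ + 1‖ := by
      rw [Real.norm_of_nonneg (by positivity)]
      exact (lt_add_one _).le
    refine ⟨r * (‖c‖ + 1), by positivity, ?_⟩
    rw [smul_comm, mul_smul]
    exact Set.smul_mem_smul_set (hbal.smul_mono hc (Set.smul_mem_smul_set hz))

theorem absorbent_preimage_span {K : Set E} (hbal : Balanced 𝕜 K) (hconv : Convex ℝ K)
    (hne : K.Nonempty) : Absorbent ℝ ((↑) ⁻¹' K : Set (Submodule.span 𝕜 K)) := fun x => by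
  obtain ⟨r, hr, z, hz, hzx⟩ := exists_mem_smul_of_mem_span hbal hconv hne x.2
  refine absorbs_iff_norm.2 ⟨r, fun c hc => Set.singleton_subset_iff.2 ?_⟩
  have hc0 : c ≠ 0 := norm_pos_iff.1 (hr.trans_le hc)
  refine ⟨c⁻¹ • x, ?_, smul_inv_smul₀ hc0 x⟩
  have hrc : ‖c⁻¹ * r‖ ≤ 1 := by
    rw [norm_mul, norm_inv, Real.norm_of_nonneg hr.le]
    exact inv_mul_le_one_of_le₀ hc (norm_nonneg c)
  rw [Set.mem_preimage, Submodule.coe_smul_of_tower, ← hzx, smul_smul, ← algebraMap_smul 𝕜]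
  exact hbal.smul_mem (by simpa using hrc) hz

-- The gauge of `K` is a seminorm on the span of `K`, which reduces this to
-- `exists_norm_sub_sum_le_seminorm` there.
theorem exists_norm_sub_sum_le_of_balanced_of_convex {ι : Type*} [Fintype ι] {K : Set E}
    (hbal : Balanced 𝕜 K) (hconv : Convex ℝ K) (hne : K.Nonempty) (f : Module.Dual 𝕜 E)
    (L : ι → Module.Dual 𝕜 E) {ε : ℝ} (h : ∀ x ∈ K, (∀ i, L i x = 0) → ‖f x‖ ≤ ε) :
    ∃ c : ι → 𝕜, ∀ x ∈ K, ‖f x - ∑ i, c i * L i x‖ ≤ ε := by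
  let S := Submodule.span 𝕜 K
  have hbal' : Balanced 𝕜 ((↑) ⁻¹' K : Set S) :=
    balanced_iff_smul_mem.2 fun _ ha _ hx => hbal.smul_mem ha hx
  have hconv' : Convex ℝ ((↑) ⁻¹' K : Set S) := hconv.linear_preimage (S.subtype.restrictScalars ℝ)
  have habs : Absorbent ℝ ((↑) ⁻¹' K : Set S) := absorbent_preimage_span hbal hconv hne
  lift ε to NNReal using (norm_nonneg _).trans (h 0 (hbal.zero_mem hne) (by simp))
  have hf : ∀ x : S, (∀ i, (L i).domRestrict S x = 0) →
      ‖f.domRestrict S x‖ ≤ (ε • gaugeSeminorm hbal' hconv' habs) x := by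
    refine fun x hx => le_mul_of_forall_lt₀ fun a ha r hr => ?_
    obtain ⟨s, hs, hsr, z, hz, rfl⟩ := exists_lt_of_gauge_lt habs hr
    have hsz : ((s • z : S) : E) = (s : 𝕜) • (z : E) := (algebraMap_smul 𝕜 s (z : E)).symm
    have hLz : ∀ i, L i z = 0 := fun i => by
      simpa [hsz, hs.ne'] using hx i
    calc ‖f (s • z : S)‖ = ‖f z‖ * s := by
          rw [hsz, map_smul, norm_smul, RCLike.norm_ofReal, abs_of_pos hs, mul_comm]
      _ ≤ a * r := mul_le_mul ((h z hz hLz).trans ha.le) hsr.le hs.le (ε.2.trans ha.le)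
  obtain ⟨c, hc⟩ := exists_norm_sub_sum_le_seminorm _ _ _ hf
  exact ⟨c, fun x hx => (hc ⟨x, Submodule.subset_span hx⟩).trans
    (mul_le_of_le_one_right ε.2 (gauge_le_one_of_mem hx))⟩

end HahnBanach

section LocallyConvex

variable {𝕜 E : Type*} [RCLike 𝕜] [AddCommGroup E] [Module 𝕜 E]

theorem convex_of_convex_real {s : Set 𝕜} (hs : Convex ℝ s) : Convex 𝕜 s :=
  convex_of_nonneg_surjective_algebraMap _ (fun _ => RCLike.nonneg_iff_exists_ofReal.mp) hs

theorem locallyConvexSpace_self (𝕜 : Type*) [RCLike 𝕜] : LocallyConvexSpace 𝕜 𝕜 :=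
  .ofBasisZero 𝕜 𝕜 (Metric.ball 0) (0 < ·) Metric.nhds_basis_ball
    fun r _ => convex_of_convex_real (convex_ball 0 r)

theorem absConvex_setOf_norm_le (f : Module.Dual 𝕜 E) (r : ℝ) : AbsConvex 𝕜 {x | ‖f x‖ ≤ r} := by
  have h : Convex 𝕜 (Metric.closedBall (0 : 𝕜) r) := convex_of_convex_real (convex_closedBall 0 r)
  refine ⟨balanced_iff_smul_mem.2 fun a ha x hx => ?_, ?_⟩
  · rw [Set.mem_ofPred_eq, map_smul, smul_eq_mul, norm_mul]
    exact (mul_le_of_le_one_left (norm_nonneg _) ha).trans hx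
  · simpa [Set.preimage] using h.linear_preimage f

variable [TopologicalSpace E]

theorem continuous_dual_of_norm_le [IsTopologicalAddGroup E] (f : Module.Dual 𝕜 E)
    {p : Seminorm 𝕜 E} (hp : Continuous p) (h : ∀ x, ‖f x‖ ≤ p x) : Continuous f := by
  refine continuous_of_continuousAt_zero f ?_
  rw [ContinuousAt, map_zero]
  exact squeeze_zero_norm h (map_zero p ▸ hp.tendsto 0)

theorem exists_continuous_seminorm_le_one_subset [IsTopologicalAddGroup E] [ContinuousSMul 𝕜 E]
    [LocallyConvexSpace 𝕜 E] {V : Set E} (hV : V ∈ 𝓝 (0 : E)) :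
    ∃ p : Seminorm 𝕜 E, Continuous p ∧ {x | p x ≤ 1} ⊆ V := by
  let : Module ℝ E := .restrictScalars ℝ 𝕜 E
  have : IsScalarTower ℝ 𝕜 E := .restrictScalars _ _ _
  have : ContinuousSMul ℝ E := IsScalarTower.continuousSMul 𝕜
  obtain ⟨s, hs, hsV⟩ := (nhds_hasBasis_absConvex_open 𝕜 E).mem_iff.1 hV
  let p := gaugeSeminormFamily 𝕜 E ⟨s, hs⟩
  have hp : Continuous p := with_gaugeSeminormFamily.continuous_seminorm _
  have hps : p.ball 0 1 = s := gaugeSeminormFamily_ball _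
  refine ⟨(2 : NNReal) • p, hp.const_smul (2 : NNReal), fun x hx => hsV ?_⟩
  have hx' : 2 * p x ≤ 1 := hx
  refine hps.subset ((p.mem_ball_zero).2 ?_)
  linarith

theorem exists_forall_seminorm_le_of_isVonNBounded {p : Seminorm 𝕜 E} (hp : Continuous p)
    {S : Set E} (hS : IsVonNBounded 𝕜 S) : ∃ r : ℝ, ∀ x ∈ S, p x ≤ r := by
  have hV : {x | p x < 1} ∈ 𝓝 (0 : E) := (isOpen_lt hp continuous_const).mem_nhds (by simp)
  obtain ⟨r, hr, hrS⟩ := (hS hV).exists_pos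
  refine ⟨r, fun x hx => ?_⟩
  obtain ⟨z, hz, rfl⟩ := hrS (r : 𝕜) (by simp [abs_of_pos hr]) hx
  rw [map_smul_eq_mul, RCLike.norm_ofReal, abs_of_pos hr]
  exact mul_le_of_le_one_right hr.le (le_of_lt hz)

end LocallyConvex

section PairingTopology

variable {𝕜 X Y : Type*} [RCLike 𝕜] [AddCommGroup Y] [Module 𝕜 Y] [TopologicalSpace Y]

theorem sigmaTopology_eq_induced (φ : X → StrongDual 𝕜 Y) :
    sigmaTopology φ = Pi.topologicalSpace.induced fun x y => φ x y := by
  have h := (PointwiseConvergenceCLM.isEmbedding_coeFn (RingHom.id 𝕜) Y 𝕜).eq_induced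
  have h' := congrArg (TopologicalSpace.induced fun x =>
    UniformConvergenceCLM.ofFun (RingHom.id 𝕜) 𝕜 {s : Set Y | Finite s} (φ x)) h
  rw [induced_compose] at h'
  exact h'

theorem pairingTopology_eq_induced (φ : X → StrongDual 𝕜 Y) (𝔖 : Set (Set Y)) :
    pairingTopology φ 𝔖 = (UniformOnFun.topologicalSpace Y 𝕜 𝔖).induced
      fun x => UniformOnFun.ofFun 𝔖 (φ x) := by
  rw [pairingTopology, UniformConvergenceCLM.topologicalSpace_eq, induced_compose]
  rfl

theorem pairingTopology_anti (φ : X → StrongDual 𝕜 Y) {𝔖 𝔗 : Set (Set Y)} (h : 𝔖 ⊆ 𝔗) :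
    pairingTopology φ 𝔗 ≤ pairingTopology φ 𝔖 :=
  induced_mono (UniformConvergenceCLM.topologicalSpace_mono _ _ h)

theorem compactTopology_le_sigmaTopology (φ : X → StrongDual 𝕜 Y) :
    compactTopology φ ≤ sigmaTopology φ :=
  pairingTopology_anti φ fun _ => Set.Finite.isCompact

theorem continuous_sigmaTopology_apply (φ : X → StrongDual 𝕜 Y) (y : Y) :
    Continuous[sigmaTopology φ, _] fun x => φ x y := by
  let := sigmaTopology φ
  have h : IsInducing fun x y => φ x y := ⟨sigmaTopology_eq_induced φ⟩
  exact (continuous_apply y).comp h.continuous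

theorem isClosed_sigmaTopology_setOf_norm_le (φ : X → StrongDual 𝕜 Y) (S : Set Y) (r : ℝ) :
    IsClosed[sigmaTopology φ] {x | ∀ y ∈ S, ‖φ x y‖ ≤ r} := by
  let := sigmaTopology φ
  simp only [Set.ofPred_forall]
  exact isClosed_biInter fun y _ =>
    isClosed_le (continuous_sigmaTopology_apply φ y).norm continuous_const

variable [AddCommGroup X] [Module 𝕜 X] {F : Type*} [FunLike F X (StrongDual 𝕜 Y)]
  [LinearMapClass F 𝕜 X (StrongDual 𝕜 Y)]

/-- The linear map `Y → X*` into the algebraic dual that corresponds to `φ : X → Y'`. -/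
def transpose (φ : F) : Y →ₗ[𝕜] Module.Dual 𝕜 X :=
  (ContinuousLinearMap.coeLM 𝕜 ∘ₗ (φ : X →ₗ[𝕜] StrongDual 𝕜 Y)).flip

@[simp]
theorem transpose_apply (φ : F) (y : Y) (x : X) : transpose φ y x = φ x y := rfl

theorem absConvex_setOf_forall_norm_apply_le (φ : F) (S : Set Y) (r : Y → ℝ) :
    AbsConvex 𝕜 {x | ∀ y ∈ S, ‖φ x y‖ ≤ r y} := by
  simp only [Set.ofPred_forall]
  exact .iInter₂ fun y _ => absConvex_setOf_norm_le (transpose φ y) (r y)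

/-- `φ` as a linear map into the dual of `Y` with the topology of uniform convergence on the members
of `𝔖`; `pairingTopology φ 𝔖` is the topology it induces. -/
def toUniformDual (φ : F) (𝔖 : Set (Set Y)) :
    X →ₗ[𝕜] UniformConvergenceCLM (RingHom.id 𝕜) 𝕜 𝔖 :=
  (ContinuousLinearMap.toUniformConvergenceCLM (RingHom.id 𝕜) 𝕜 𝔖).toLinearMap ∘ₗ
    (φ : X →ₗ[𝕜] StrongDual 𝕜 Y)

theorem hasBasis_nhds_zero_pairingTopology (φ : F) {𝔖 : Set (Set Y)} (hne : 𝔖.Nonempty)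
    (hdir : DirectedOn (· ⊆ ·) 𝔖) :
    (@nhds X (pairingTopology φ 𝔖) 0).HasBasis (fun Sr : Set Y × ℝ => Sr.1 ∈ 𝔖 ∧ 0 < Sr.2)
      fun Sr => {x | ∀ y ∈ Sr.1, ‖φ x y‖ ≤ Sr.2} := by
  have hbasis := UniformConvergenceCLM.hasBasis_nhds_zero_of_basis (RingHom.id 𝕜) 𝕜 𝔖 hne hdir
    (Metric.nhds_basis_closedBall (x := (0 : 𝕜)))
  rw [← map_zero (toUniformDual φ 𝔖)] at hbasis
  convert! hbasis.comap (toUniformDual φ 𝔖) using 1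
  · exact nhds_induced _ _
  · ext Sr x
    simp only [Set.mem_ofPred_eq, Set.mem_preimage, mem_closedBall_zero_iff]
    rfl

theorem setOf_norm_le_mem_nhds_zero_pairingTopology (φ : F) {𝔖 : Set (Set Y)} {S : Set Y}
    (hS : S ∈ 𝔖) {r : ℝ} (hr : 0 < r) :
    {x | ∀ y ∈ S, ‖φ x y‖ ≤ r} ∈ @nhds X (pairingTopology φ 𝔖) 0 := by
  have hmem : {f : UniformConvergenceCLM (RingHom.id 𝕜) 𝕜 𝔖 |
      Set.MapsTo f S (Metric.closedBall 0 r)} ∈ 𝓝 (toUniformDual φ 𝔖 0) := by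
    rw [map_zero]
    exact UniformConvergenceCLM.eventually_nhds_zero_mapsTo _ hS (Metric.closedBall_mem_nhds 0 hr)
  refine (nhds_induced (toUniformDual φ 𝔖) 0).symm ▸ ⟨_, hmem, fun x hx y hy => ?_⟩
  exact mem_closedBall_zero_iff.1 (hx hy)

theorem isTopologicalAddGroup_pairingTopology (φ : F) (𝔖 : Set (Set Y)) :
    @IsTopologicalAddGroup X (pairingTopology φ 𝔖) _ :=
  topologicalAddGroup_induced (toUniformDual φ 𝔖)

theorem isLCHausdorff_pairingTopology (φ : F) (hφ : Function.Injective φ) {𝔖 : Set (Set Y)}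
    (hne : 𝔖.Nonempty) (hdir : DirectedOn (· ⊆ ·) 𝔖) (hcov : ⋃₀ 𝔖 = Set.univ)
    (hbdd : ∀ S ∈ 𝔖, IsVonNBounded 𝕜 S) : IsLCHausdorff 𝕜 (pairingTopology φ 𝔖) := by
  have := UniformConvergenceCLM.continuousSMul (RingHom.id 𝕜) 𝕜 𝔖 hbdd
  have := locallyConvexSpace_self 𝕜
  have := UniformConvergenceCLM.locallyConvexSpace (σ := RingHom.id 𝕜) (F := 𝕜) 𝕜 𝔖 hne hdir
  have := UniformConvergenceCLM.t2Space (RingHom.id 𝕜) 𝕜 𝔖 hcov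
  have hinj : Function.Injective (toUniformDual φ 𝔖) := hφ
  have hcont : Continuous[pairingTopology φ 𝔖, _] (toUniformDual φ 𝔖) := continuous_induced_dom
  exact ⟨isTopologicalAddGroup_pairingTopology φ 𝔖, continuousSMul_induced (toUniformDual φ 𝔖),
    .induced (toUniformDual φ 𝔖), @T2Space.of_injective_continuous _ _ (_) _ _ _ hinj hcont⟩

theorem isLCHausdorff_sigmaTopology [ContinuousSMul 𝕜 Y] (φ : F) (hφ : Function.Injective φ) :
    IsLCHausdorff 𝕜 (sigmaTopology φ) :=
  isLCHausdorff_pairingTopology φ hφ ⟨∅, Set.finite_empty⟩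
    (directedOn_of_sup_mem fun _ _ => Set.Finite.union) Set.sUnion_finite_eq_univ
    fun _ => Set.Finite.isVonNBounded

theorem isLCHausdorff_compactTopology [IsTopologicalAddGroup Y] [ContinuousSMul 𝕜 Y] (φ : F)
    (hφ : Function.Injective φ) : IsLCHausdorff 𝕜 (compactTopology φ) :=
  isLCHausdorff_pairingTopology φ hφ ⟨∅, isCompact_empty⟩
    (directedOn_of_sup_mem fun _ _ => IsCompact.union) Set.sUnion_isCompact_eq_univ
    fun _ hK => hK.isVonNBounded 𝕜

end PairingTopology

section DualBall

variable {𝕜 X Y : Type*} [RCLike 𝕜] [AddCommGroup Y] [Module 𝕜 Y] [TopologicalSpace Y]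

/-- The polar in `X` of the unit ball of the seminorm `p`, with respect to the pairing given by
`φ : X → Y'`. -/
def dualBall (φ : X → StrongDual 𝕜 Y) (p : Seminorm 𝕜 Y) : Set X :=
  {x | ∀ y, ‖φ x y‖ ≤ p y}

theorem dualBall_mono (φ : X → StrongDual 𝕜 Y) {p q : Seminorm 𝕜 Y} (h : p ≤ q) :
    dualBall φ p ⊆ dualBall φ q :=
  fun _ hx y => (hx y).trans (h y)

theorem exists_subset_dualBall {Y : Type*} [AddCommGroup Y] [Module 𝕜 Y] [UniformSpace Y]
    [IsUniformAddGroup Y] [ContinuousSMul 𝕜 Y] [BarrelledSpace 𝕜 Y] (φ : X → StrongDual 𝕜 Y)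
    {B : Set X} (h : ∀ y, ∃ r, ∀ x ∈ B, ‖φ x y‖ ≤ r) :
    ∃ p : Seminorm 𝕜 Y, Continuous p ∧ B ⊆ dualBall φ p := by
  have hequi := (norm_withSeminorms 𝕜 𝕜).banach_steinhaus (𝓕 := fun x : B => φ x) fun _ y => by
    obtain ⟨r, hr⟩ := h y
    exact ⟨r, by rintro _ ⟨x, rfl⟩; exact hr x x.2⟩
  obtain ⟨p, hp, hpB⟩ :=
    ((norm_withSeminorms 𝕜 𝕜).uniformEquicontinuous_iff_exists_continuous_seminorm
      fun x : B => (φ x : Y →ₗ[𝕜] 𝕜)).1 hequi 0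
  exact ⟨p, hp, fun x hx y => hpB ⟨x, hx⟩ y⟩

theorem equicontinuous_of_subset_dualBall [IsTopologicalAddGroup Y] (φ : X → StrongDual 𝕜 Y)
    {p : Seminorm 𝕜 Y} (hp : Continuous p) {B : Set X} (hB : B ⊆ dualBall φ p) :
    Equicontinuous fun (x : B) (y : Y) => φ x y := fun y => by
  have hlim : Filter.Tendsto (fun z => p (y - z)) (𝓝 y) (𝓝 0) :=
    (hp.comp (continuous_const.sub continuous_id')).tendsto' y 0 (by simp)
  refine Metric.equicontinuousAt_of_continuity_modulus _ hlim _ (.of_forall fun z x => ?_)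
  rw [dist_eq_norm, ← map_sub]
  exact hB x.2 (y - z)

theorem induced_compactTopology_eq_of_subset_dualBall [IsTopologicalAddGroup Y]
    (φ : X → StrongDual 𝕜 Y) {p : Seminorm 𝕜 Y} (hp : Continuous p) {B : Set X}
    (hB : B ⊆ dualBall φ p) :
    (compactTopology φ).induced (Subtype.val : B → X) =
      (sigmaTopology φ).induced (Subtype.val : B → X) := by
  rw [sigmaTopology_eq_induced, compactTopology, pairingTopology_eq_induced, induced_compose,
    induced_compose]
  let : TopologicalSpace B := Pi.topologicalSpace.induced fun (x : B) (y : Y) => φ x y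
  refine ((EquicontinuousOn.isInducing_uniformOnFun_iff_pi
    (F := fun (x : B) (y : Y) => φ x y) Set.sUnion_isCompact_eq_univ (fun _ h => h)
    fun K _ => ?_).2 ⟨rfl⟩).eq_induced.symm
  exact (equicontinuous_of_subset_dualBall φ hp hB).equicontinuousOn K

theorem isCompact_dualBall [IsTopologicalAddGroup Y] {φ : X → StrongDual 𝕜 Y}
    (hφ : Function.Surjective φ) {p : Seminorm 𝕜 Y} (hp : Continuous p) :
    @IsCompact X (sigmaTopology φ) (dualBall φ p) := by
  let := sigmaTopology φ
  have hind : IsInducing fun x y => φ x y := ⟨sigmaTopology_eq_induced φ⟩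
  have himage : (fun x y => φ x y) '' dualBall φ p =
      (Set.univ.pi fun y => Metric.closedBall (0 : 𝕜) (p y)) ∩
        Set.range ((↑) : (Y →ₗ[𝕜] 𝕜) → Y → 𝕜) := by
    ext f
    constructor
    · rintro ⟨x, hx, rfl⟩
      exact ⟨fun y _ => mem_closedBall_zero_iff.2 (hx y), (φ x : Y →ₗ[𝕜] 𝕜), rfl⟩
    · rintro ⟨hf, f, rfl⟩
      have hfp : ∀ y, ‖f y‖ ≤ p y := fun y => mem_closedBall_zero_iff.1 (hf y trivial)
      obtain ⟨x, hx⟩ := hφ ⟨f, continuous_dual_of_norm_le f hp hfp⟩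
      have hxf : (fun y => φ x y) = f := funext (DFunLike.congr_fun hx)
      exact ⟨x, fun y => congrFun hxf y ▸ hfp y, hxf⟩
  rw [hind.isCompact_iff, himage]
  exact (isCompact_univ_pi fun y => isCompact_closedBall _ _).inter_right
    (LinearMap.isClosed_range_coe Y 𝕜 (RingHom.id 𝕜))

theorem seminorm_le_of_forall_mem_dualBall [IsTopologicalAddGroup Y] {φ : X → StrongDual 𝕜 Y}
    (hφ : Function.Surjective φ) {p : Seminorm 𝕜 Y} (hp : Continuous p) {y : Y} {c : ℝ}
    (h : ∀ x ∈ dualBall φ p, ‖φ x y‖ ≤ c) : p y ≤ c := by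
  obtain ⟨f, hfp, hfy⟩ := exists_dual_le_seminorm_apply_eq p y
  obtain ⟨x, hx⟩ := hφ ⟨f, continuous_dual_of_norm_le f hp hfp⟩
  have hxf : ∀ z, φ x z = f z := DFunLike.congr_fun hx
  rw [← hfy, ← hxf]
  exact h x fun z => hxf z ▸ hfp z

theorem eq_of_forall_apply_eq [IsTopologicalAddGroup Y] [ContinuousSMul 𝕜 Y]
    [LocallyConvexSpace 𝕜 Y] [T2Space Y] {φ : X → StrongDual 𝕜 Y} (hφ : Function.Surjective φ)
    {y z : Y} (h : ∀ x, φ x y = φ x z) : y = z := by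
  by_contra hne
  obtain ⟨p, hp, hpV⟩ := exists_continuous_seminorm_le_one_subset (𝕜 := 𝕜)
    (isOpen_ne.mem_nhds (sub_ne_zero.2 hne).symm)
  refine hpV (a := y - z) (seminorm_le_of_forall_mem_dualBall hφ hp fun x _ => ?_) rfl
  simp [h x]

theorem absConvex_dualBall [AddCommGroup X] [Module 𝕜 X] {F : Type*}
    [FunLike F X (StrongDual 𝕜 Y)] [LinearMapClass F 𝕜 X (StrongDual 𝕜 Y)] (φ : F)
    (p : Seminorm 𝕜 Y) : AbsConvex 𝕜 (dualBall φ p) := by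
  simpa [dualBall] using absConvex_setOf_forall_norm_apply_le φ Set.univ p

end DualBall

section CoincidingTopologies

variable {X : Type*} {t s : TopologicalSpace X} {B : Set X}

theorem continuousOn_of_induced_eq {Z : Type*} [TopologicalSpace Z]
    (h : t.induced (Subtype.val : B → X) = s.induced (Subtype.val : B → X))
    {f : X → Z} (hf : @ContinuousOn X Z t _ f B) : @ContinuousOn X Z s _ f B := by
  rw [@continuousOn_iff_continuous_domRestrict X Z t] at hf
  rw [@continuousOn_iff_continuous_domRestrict X Z s]
  change @Continuous B Z (s.induced Subtype.val) _ _
  rwa [← h]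

theorem isCompact_of_induced_eq
    (h : t.induced (Subtype.val : B → X) = s.induced (Subtype.val : B → X))
    (hB : @IsCompact X t B) : @IsCompact X s B := by
  rw [@isCompact_iff_compactSpace X t] at hB
  rw [@isCompact_iff_compactSpace X s]
  change @CompactSpace B (s.induced Subtype.val)
  rwa [← h]

end CoincidingTopologies

section WeakApproximation

variable {𝕜 X Y : Type*} [RCLike 𝕜] [AddCommGroup X] [Module 𝕜 X] [AddCommGroup Y] [Module 𝕜 Y]

theorem exists_forall_norm_sub_apply_le [TopologicalSpace Y] {F : Type*}
    [FunLike F X (StrongDual 𝕜 Y)] [LinearMapClass F 𝕜 X (StrongDual 𝕜 Y)] (φ : F) {K : Set X}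
    (hK : AbsConvex 𝕜 K) (hne : K.Nonempty) (f : Module.Dual 𝕜 X)
    (hf : @ContinuousWithinAt X 𝕜 (sigmaTopology φ) _ f K 0) {ε : ℝ} (hε : 0 < ε) :
    ∃ y : Y, ∀ x ∈ K, ‖f x - φ x y‖ ≤ ε := by
  let : Module ℝ X := .restrictScalars ℝ 𝕜 X
  have : IsScalarTower ℝ 𝕜 X := .restrictScalars _ _ _
  have hbasis := hasBasis_nhds_zero_pairingTopology φ (𝔖 := {N | N.Finite}) ⟨∅, Set.finite_empty⟩
    (directedOn_of_sup_mem fun _ _ => Set.Finite.union)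
  obtain ⟨⟨N, r⟩, ⟨hN, hr⟩, hNf⟩ := ((hbasis.inf_principal K).tendsto_iff
    (Metric.nhds_basis_closedBall (x := f 0))).1 hf ε hε
  have := Set.Finite.fintype hN
  have hker : ∀ x ∈ K, (∀ y : N, transpose φ y x = 0) → ‖f x‖ ≤ ε := fun x hx hxN => by
    have hxr : ∀ y ∈ N, ‖φ x y‖ ≤ r := fun y hy => by
      rw [← transpose_apply, hxN ⟨y, hy⟩, norm_zero]
      exact hr.le
    simpa using hNf x ⟨hxr, hx⟩
  obtain ⟨c, hc⟩ := exists_norm_sub_sum_le_of_balanced_of_convex hK.1 (hK.2.lift ℝ) hne f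
    (fun y : N => transpose φ y) hker
  exact ⟨∑ y : N, c y • (y : Y), fun x hx => by simpa using hc x hx⟩

theorem eq_zero_of_forall_norm_le (f : Module.Dual 𝕜 X) {r : ℝ} (h : ∀ x, ‖f x‖ ≤ r) : f = 0 := by
  by_contra hf
  obtain ⟨x, hx⟩ := DFunLike.ne_iff.1 hf
  have hr : ‖((r + 1 : ℝ) : 𝕜)‖ ≤ r := by
    simpa [div_mul_cancel₀ _ hx] using h ((((r + 1 : ℝ) : 𝕜) / f x) • x)
  rw [RCLike.norm_ofReal] at hr
  linarith [le_abs_self (r + 1)]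

end WeakApproximation

section Grothendieck

variable {𝕜 X Y : Type*} [RCLike 𝕜] [AddCommGroup Y] [Module 𝕜 Y]

/-- The directed set of continuous seminorms on `Y`, which indexes the approximating net in
Grothendieck's completeness theorem. -/
abbrev ContinuousSeminorm (𝕜 Y : Type*) [RCLike 𝕜] [AddCommGroup Y] [Module 𝕜 Y]
    [TopologicalSpace Y] : Type _ :=
  {p : Seminorm 𝕜 Y // Continuous p}

instance [TopologicalSpace Y] : SemilatticeSup (ContinuousSeminorm 𝕜 Y) :=
  Subtype.semilatticeSup fun p q hp hq => by
    rw [Seminorm.coe_sup]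
    exact hp.sup hq

instance [TopologicalSpace Y] : Nonempty (ContinuousSeminorm 𝕜 Y) := ⟨⟨0, continuous_const⟩⟩

variable [UniformSpace Y] [IsUniformAddGroup Y] [ContinuousSMul 𝕜 Y] [LocallyConvexSpace 𝕜 Y]

theorem cauchySeq_of_forall_norm_sub_apply_le {φ : X → StrongDual 𝕜 Y}
    (hφ : Function.Surjective φ) (f : X → 𝕜) {u : ContinuousSeminorm 𝕜 Y → Y}
    (hu : ∀ p, ∀ x ∈ dualBall φ p.1, ‖f x - φ x (u p)‖ ≤ 1 / 2) : CauchySeq u := by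
  refine (𝓝 (0 : Y)).basis_sets.uniformity_of_nhds_zero.cauchySeq_iff'.2 fun V hV => ?_
  obtain ⟨p, hp, hpV⟩ := exists_continuous_seminorm_le_one_subset (𝕜 := 𝕜) hV
  refine ⟨⟨p, hp⟩, fun q hpq => hpV (seminorm_le_of_forall_mem_dualBall hφ hp fun x hx => ?_)⟩
  calc ‖φ x (u ⟨p, hp⟩ - u q)‖ = ‖(f x - φ x (u q)) - (f x - φ x (u ⟨p, hp⟩))‖ := by
        rw [map_sub, sub_sub_sub_cancel_left]
    _ ≤ 1 / 2 + 1 / 2 := norm_sub_le_of_le (hu q x (dualBall_mono φ hpq hx)) (hu _ x hx)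
    _ = 1 := add_halves 1

theorem exists_eq_apply_of_continuousOn_dualBall [CompleteSpace Y] [AddCommGroup X]
    [Module 𝕜 X] {F : Type*} [FunLike F X (StrongDual 𝕜 Y)]
    [LinearMapClass F 𝕜 X (StrongDual 𝕜 Y)] {φ : F} (hφ : Function.Surjective φ)
    (f : Module.Dual 𝕜 X)
    (hf : ∀ p : Seminorm 𝕜 Y, Continuous p →
      @ContinuousOn X 𝕜 (sigmaTopology φ) _ f (dualBall φ p)) :
    ∃ y, ∀ x, f x = φ x y := by
  have hzero : ∀ p : Seminorm 𝕜 Y, (0 : X) ∈ dualBall φ p := fun p y => by simp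
  choose u hu using fun p : ContinuousSeminorm 𝕜 Y =>
    exists_forall_norm_sub_apply_le φ (absConvex_dualBall φ p.1) ⟨0, hzero p⟩ f
      (hf p p.2 0 (hzero p)) one_half_pos
  obtain ⟨y, hy⟩ := cauchySeq_tendsto_of_complete (cauchySeq_of_forall_norm_sub_apply_le hφ f hu)
  refine ⟨y, fun x => sub_eq_zero.1 (DFunLike.congr_fun
    (eq_zero_of_forall_norm_le (f - transpose φ y) (r := 1 / 2) fun x => ?_) x)⟩
  let p : Seminorm 𝕜 Y := (normSeminorm 𝕜 𝕜).comp (φ x : Y →ₗ[𝕜] 𝕜)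
  refine le_of_tendsto ((((φ x).continuous.tendsto y).comp hy).const_sub (f x)).norm ?_
  filter_upwards [Filter.eventually_ge_atTop ⟨p, (φ x).continuous.norm⟩] with q hq
  exact hu q x fun y => hq y

end Grothendieck

section Transpose

variable {𝕜 X Y : Type*} [RCLike 𝕜] [AddCommGroup X] [Module 𝕜 X] [TopologicalSpace X]
  [AddCommGroup Y] [Module 𝕜 Y] [TopologicalSpace Y] {F : Type*} [FunLike F X (StrongDual 𝕜 Y)]
  [LinearMapClass F 𝕜 X (StrongDual 𝕜 Y)]

theorem pairingTopology_le_of_dualBall_mem [IsTopologicalAddGroup Y] [ContinuousSMul 𝕜 Y]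
    [LocallyConvexSpace 𝕜 Y] {φ : X → StrongDual 𝕜 Y} (hφ : Function.Surjective φ)
    {G : Type*} [FunLike G Y (StrongDual 𝕜 X)] [LinearMapClass G 𝕜 Y (StrongDual 𝕜 X)] (ψ : G)
    (hψ : ∀ x y, ψ y x = φ x y) {𝔖 : Set (Set X)}
    (h𝔖 : ∀ p : Seminorm 𝕜 Y, Continuous p → dualBall φ p ∈ 𝔖) :
    pairingTopology ψ 𝔖 ≤ ‹TopologicalSpace Y› := by
  have := isTopologicalAddGroup_pairingTopology ψ 𝔖
  refine continuous_id_iff_le.1 (@continuous_of_continuousAt_zero Y (pairingTopology ψ 𝔖) _ this Y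
    _ _ _ _ _ _ (AddMonoidHom.id Y) fun V hV => ?_)
  obtain ⟨p, hp, hpV⟩ := exists_continuous_seminorm_le_one_subset (𝕜 := 𝕜) hV
  refine Filter.mem_of_superset
    (setOf_norm_le_mem_nhds_zero_pairingTopology ψ (h𝔖 p hp) one_pos) fun y hy => hpV ?_
  exact seminorm_le_of_forall_mem_dualBall hφ hp fun x hx => hψ x y ▸ hy x hx

/-- The transpose `Y → X'` of `φ : X → Y'`, for a topology on `X` that makes every functional
`x ↦ φ x y` continuous. -/
def continuousTranspose (φ : F) (h : ∀ y, Continuous fun x => φ x y) : Y →ₗ[𝕜] StrongDual 𝕜 X where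
  toFun y := ⟨transpose φ y, h y⟩
  map_add' y z := ContinuousLinearMap.coe_injective (map_add (transpose φ) y z)
  map_smul' c y := ContinuousLinearMap.coe_injective (map_smul (transpose φ) c y)

-- Applied to the transposed pairing, Alaoglu's and Ascoli's theorems show that the polars in `Y` of
-- the continuous seminorms on `X` are compact.
theorem compactTopology_le_of_surjective [IsTopologicalAddGroup X] [ContinuousSMul 𝕜 X]
    [LocallyConvexSpace 𝕜 X] [IsTopologicalAddGroup Y] [ContinuousSMul 𝕜 Y]
    [LocallyConvexSpace 𝕜 Y] {φ : F} (hφ : Function.Surjective φ)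
    (hcont : ∀ y, Continuous fun x => φ x y)
    (hsurj : Function.Surjective (continuousTranspose φ hcont))
    (hcompact : ∀ p : Seminorm 𝕜 Y, Continuous p → IsCompact (dualBall φ p)) :
    compactTopology φ ≤ ‹TopologicalSpace X› := by
  let ψ := continuousTranspose φ hcont
  have hψY : compactTopology ψ ≤ ‹TopologicalSpace Y› :=
    pairingTopology_le_of_dualBall_mem hφ ψ (fun _ _ => rfl) (𝔖 := {K | IsCompact K}) hcompact
  refine pairingTopology_le_of_dualBall_mem hsurj φ (fun _ _ => rfl) fun q hq => ?_
  have hball : @IsCompact Y (compactTopology ψ) (dualBall ψ q) :=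
    isCompact_of_induced_eq (induced_compactTopology_eq_of_subset_dualBall ψ hq subset_rfl).symm
      (isCompact_dualBall hsurj hq)
  have himage := @IsCompact.image Y Y (compactTopology ψ) _ _ id hball (continuous_id_iff_le.2 hψY)
  rwa [Set.image_id] at himage

end Transpose

section CompactTopology

variable {𝕜 X Y : Type*} [RCLike 𝕜] [AddCommGroup X] [Module 𝕜 X] [AddCommGroup Y] [Module 𝕜 Y]
  [UniformSpace Y] [IsUniformAddGroup Y] [ContinuousSMul 𝕜 Y] [LocallyConvexSpace 𝕜 Y]
  [CompleteSpace Y] {F : Type*} [FunLike F X (StrongDual 𝕜 Y)]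
  [LinearMapClass F 𝕜 X (StrongDual 𝕜 Y)] {φ : F} {t : TopologicalSpace X}

theorem exists_eq_apply_of_continuous (hφ : Function.Surjective φ)
    (hco : ∀ p : Seminorm 𝕜 Y, Continuous p → t.induced (Subtype.val : dualBall φ p → X) =
      (sigmaTopology φ).induced Subtype.val)
    {f : Module.Dual 𝕜 X} (hf : Continuous[t, _] f) : ∃ y, ∀ x, f x = φ x y :=
  exists_eq_apply_of_continuousOn_dualBall hφ f fun p hp =>
    continuousOn_of_induced_eq (hco p hp) hf.continuousOn

theorem compactTopology_le_of_induced_eq (hφ : Function.Surjective φ) (ht : IsLCHausdorff 𝕜 t)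
    (htσ : t ≤ sigmaTopology φ)
    (hco : ∀ p : Seminorm 𝕜 Y, Continuous p → t.induced (Subtype.val : dualBall φ p → X) =
      (sigmaTopology φ).induced Subtype.val) : compactTopology φ ≤ t := by
  have := ht.isTopologicalAddGroup
  have := ht.continuousSMul
  have := ht.locallyConvexSpace
  have hcont : ∀ y, Continuous fun x => φ x y := fun y =>
    continuous_le_dom htσ (continuous_sigmaTopology_apply φ y)
  refine compactTopology_le_of_surjective hφ hcont (fun f => ?_) fun p hp =>
    isCompact_of_induced_eq (hco p hp).symm (isCompact_dualBall hφ hp)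
  obtain ⟨y, hy⟩ := exists_eq_apply_of_continuous hφ hco (f := f) f.continuous
  exact ⟨y, ContinuousLinearMap.ext fun x => (hy x).symm⟩

end CompactTopology

section Barrelled

variable {𝕜 X Y : Type*} [RCLike 𝕜] [AddCommGroup X] [Module 𝕜 X] [AddCommGroup Y] [Module 𝕜 Y]
  [UniformSpace Y] [IsUniformAddGroup Y] [ContinuousSMul 𝕜 Y] [BarrelledSpace 𝕜 Y] {F : Type*}
  [FunLike F X (StrongDual 𝕜 Y)] [LinearMapClass F 𝕜 X (StrongDual 𝕜 Y)]

theorem exists_subset_dualBall_of_isBddFor (φ : F) {t : TopologicalSpace X}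
    (ht : t ≤ sigmaTopology φ) {B : Set X} (hB : IsBddFor 𝕜 t B) :
    ∃ p : Seminorm 𝕜 Y, Continuous p ∧ B ⊆ dualBall φ p :=
  exists_subset_dualBall φ fun y => exists_forall_seminorm_le_of_isVonNBounded
    (p := (normSeminorm 𝕜 𝕜).comp (transpose φ y))
    (continuous_le_dom ht (continuous_sigmaTopology_apply φ y)).norm hB

end Barrelled

section Predual

variable {𝕜 X Y : Type*} [RCLike 𝕜] [AddCommGroup X] [Module 𝕜 X] {τ : TopologicalSpace X}
  [AddCommGroup Y] [Module 𝕜 Y]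

section TopologicalSpace

variable [TopologicalSpace Y] (φ : X ≃L[𝕜] StrongDual 𝕜 Y)

theorem isBddFor_of_subset_dualBall {p : Seminorm 𝕜 Y} (hp : Continuous p) {B : Set X}
    (hB : B ⊆ dualBall φ p) : IsBddFor 𝕜 τ B := by
  have himage : IsVonNBounded 𝕜 (φ '' B) := by
    refine ContinuousLinearMap.isVonNBounded_iff.2 fun S hS => ?_
    obtain ⟨r, hr⟩ := exists_forall_seminorm_le_of_isVonNBounded hp hS
    refine (NormedSpace.isVonNBounded_iff' 𝕜).2 ⟨r, ?_⟩
    rintro _ ⟨_, ⟨x, hx, rfl⟩, y, hy, rfl⟩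
    exact (hB hx y).trans (hr y hy)
  have h := himage.image (φ.symm : StrongDual 𝕜 Y →L[𝕜] X)
  rwa [ContinuousLinearEquiv.coe_coe, φ.symm_image_image] at h

theorem topology_eq_pairingTopology : τ = pairingTopology φ {S | IsVonNBounded 𝕜 S} :=
  φ.toHomeomorph.isInducing.eq_induced

theorem cnc_sigmaTopology [ContinuousSMul 𝕜 Y] : CNC 𝕜 τ (sigmaTopology φ) := by
  have hbasis := hasBasis_nhds_zero_pairingTopology φ (𝔖 := {S | IsVonNBounded 𝕜 S})
    ⟨∅, isVonNBounded_empty 𝕜 Y⟩ (directedOn_of_sup_mem fun _ _ => IsVonNBounded.union)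
  rw [← topology_eq_pairingTopology φ] at hbasis
  refine ⟨isLCHausdorff_sigmaTopology φ φ.injective,
    (fun Sr : Set Y × ℝ => {x | ∀ y ∈ Sr.1, ‖φ x y‖ ≤ Sr.2}) ''
      {Sr | Sr.1 ∈ {S | IsVonNBounded 𝕜 S} ∧ 0 < Sr.2}, ?_, ?_⟩
  · rintro _ ⟨Sr, -, rfl⟩
    exact ⟨absConvex_setOf_forall_norm_apply_le φ Sr.1 fun _ => Sr.2,
      isClosed_sigmaTopology_setOf_norm_le φ Sr.1 Sr.2⟩
  · refine hbasis.to_hasBasis (fun Sr hSr => ⟨_, ⟨Sr, hSr, rfl⟩, subset_rfl⟩) ?_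
    rintro _ ⟨Sr, hSr, rfl⟩
    exact ⟨Sr, hSr, subset_rfl⟩

end TopologicalSpace

variable [UniformSpace Y] [IsUniformAddGroup Y] [ContinuousSMul 𝕜 Y]

theorem topology_le_compactTopology (φ : X ≃L[𝕜] StrongDual 𝕜 Y) : τ ≤ compactTopology φ :=
  (topology_eq_pairingTopology φ).trans_le <|
    pairingTopology_anti φ fun _ hK => IsCompact.isVonNBounded 𝕜 hK

theorem topology_le_sigmaTopology (φ : X ≃L[𝕜] StrongDual 𝕜 Y) : τ ≤ sigmaTopology φ :=
  (topology_le_compactTopology φ).trans (compactTopology_le_sigmaTopology φ)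

variable [BarrelledSpace 𝕜 Y] (φ : X ≃L[𝕜] StrongDual 𝕜 Y)

theorem isBddFor_iff_exists_subset_dualBall {t : TopologicalSpace X} (hτt : τ ≤ t)
    (htσ : t ≤ sigmaTopology φ) {B : Set X} :
    IsBddFor 𝕜 t B ↔ ∃ p : Seminorm 𝕜 Y, Continuous p ∧ B ⊆ dualBall φ p :=
  ⟨exists_subset_dualBall_of_isBddFor φ htσ, fun ⟨_, hp, hB⟩ =>
    IsVonNBounded.of_topologicalSpace_le hτt (isBddFor_of_subset_dualBall φ hp hB)⟩

theorem sameBdd_compactTopology : SameBdd 𝕜 τ (compactTopology φ) := fun _ =>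
  (isBddFor_iff_exists_subset_dualBall φ le_rfl (topology_le_sigmaTopology φ)).trans
    (isBddFor_iff_exists_subset_dualBall φ (topology_le_compactTopology φ)
      (compactTopology_le_sigmaTopology φ)).symm

theorem bbc_sigmaTopology : BBC 𝕜 τ (sigmaTopology φ) := by
  refine ⟨isLCHausdorff_sigmaTopology φ φ.injective, fun B hB => ?_⟩
  obtain ⟨p, hp, hBp⟩ := exists_subset_dualBall_of_isBddFor φ (topology_le_sigmaTopology φ) hB
  exact ⟨dualBall φ p, hBp, absConvex_dualBall φ p, isBddFor_of_subset_dualBall φ hp subset_rfl,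
    isCompact_dualBall φ.surjective hp⟩

theorem coincideOnBdd_compactTopology :
    CoincideOnBdd 𝕜 τ (sigmaTopology φ) (compactTopology φ) := fun B hB => by
  obtain ⟨p, hp, hBp⟩ := exists_subset_dualBall_of_isBddFor φ (topology_le_sigmaTopology φ) hB
  exact induced_compactTopology_eq_of_subset_dualBall φ hp hBp

theorem mixedTopologyOf_eq_compactTopology [LocallyConvexSpace 𝕜 Y] [CompleteSpace Y] :
    mixedTopologyOf τ φ = compactTopology φ := by
  have hσ := isLCHausdorff_sigmaTopology φ φ.injective
  obtain ⟨⟨hLC, hco⟩, hleast⟩ := isLeast_mixedTopology 𝕜 τ hσ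
  refine le_antisymm (hleast ⟨isLCHausdorff_compactTopology φ φ.injective,
    coincideOnBdd_compactTopology φ⟩) ?_
  exact compactTopology_le_of_induced_eq φ.surjective hLC (hleast ⟨hσ, fun _ _ => rfl⟩)
    fun p hp => hco _ (isBddFor_of_subset_dualBall φ hp subset_rfl)

end Predual

section WithTopology

variable {𝕜 X : Type*} [RCLike 𝕜] [AddCommGroup X] [Module 𝕜 X]

variable (𝕜) in
/-- The identity map from `X` to its copy with the topology `t`. -/
def toTopologyLinearEquiv (t : TopologicalSpace X) : X ≃ₗ[𝕜] WithTopology X t :=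
  ((WithTopology.equiv X t).linearEquiv 𝕜).symm

theorem isVonNBounded_withTopology_iff {t : TopologicalSpace X} {B : Set (WithTopology X t)} :
    IsVonNBounded 𝕜 B ↔ IsBddFor 𝕜 t (WithTopology.toTopology t ⁻¹' B) := by
  let ofTop : WithTopology X t →L[𝕜] X :=
    ⟨(toTopologyLinearEquiv 𝕜 t).symm, WithTopology.continuous_ofTopology t⟩
  let toTop : X →L[𝕜] WithTopology X t :=
    ⟨toTopologyLinearEquiv 𝕜 t, WithTopology.continuous_toTopology t⟩
  refine ⟨fun h => ?_, fun h => ?_⟩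
  · rw [← WithTopology.image_ofTopology]
    exact h.image ofTop
  · rw [← Set.image_preimage_eq B (WithTopology.toTopology_surjective t)]
    exact IsVonNBounded.image h toTop

/-- A linear bijection that induces the topology of its domain, as a topological isomorphism. -/
def continuousLinearEquivOfIsInducing {E F : Type*} [AddCommMonoid E] [Module 𝕜 E]
    [TopologicalSpace E] [AddCommMonoid F] [Module 𝕜 F] [TopologicalSpace F] (f : E →ₗ[𝕜] F)
    (hf : Function.Bijective f) (h : IsInducing f) : E ≃L[𝕜] F where
  toLinearEquiv := .ofBijective f hf
  continuous_toFun := h.continuous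
  continuous_invFun :=
    ((LinearEquiv.ofBijective f hf).toEquiv.toHomeomorphOfIsInducing h).symm.continuous

end WithTopology

section TransposeWithTopology

variable {𝕜 X Y : Type*} [RCLike 𝕜] [AddCommGroup X] [Module 𝕜 X] [AddCommGroup Y] [Module 𝕜 Y]
  {F : Type*}

theorem isInducing_continuousTranspose [TopologicalSpace X] [TopologicalSpace Y]
    [IsTopologicalAddGroup Y] [ContinuousSMul 𝕜 Y] [LocallyConvexSpace 𝕜 Y]
    [FunLike F X (StrongDual 𝕜 Y)] [LinearMapClass F 𝕜 X (StrongDual 𝕜 Y)] {φ : F}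
    (hφ : Function.Surjective φ) (hcont : ∀ y, Continuous fun x => φ x y)
    (hbdd : ∀ B : Set X, IsVonNBounded 𝕜 B ↔
      ∃ p : Seminorm 𝕜 Y, Continuous p ∧ B ⊆ dualBall φ p) :
    IsInducing (continuousTranspose φ hcont) := by
  let ψ := continuousTranspose φ hcont
  refine ⟨le_antisymm (continuous_of_continuousAt_zero ψ ?_).le_induced
    (pairingTopology_le_of_dualBall_mem hφ ψ (fun _ _ => rfl) fun p hp =>
      (hbdd _).2 ⟨p, hp, subset_rfl⟩)⟩
  rw [ContinuousAt, map_zero, (ContinuousLinearMap.hasBasis_nhds_zero_of_basis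
    (Metric.nhds_basis_closedBall (x := (0 : 𝕜)))).tendsto_right_iff]
  rintro ⟨B, r⟩ ⟨hB, hr⟩
  obtain ⟨p, hp, hBp⟩ := (hbdd B).1 hB
  have hpr : ∀ᶠ y in 𝓝 (0 : Y), p y < r :=
    (hp.tendsto 0).eventually_lt_const (by simpa using hr)
  filter_upwards [hpr] with y hy x hx
  exact mem_closedBall_zero_iff.2 ((hBp hx y).trans hy.le)

section

variable [TopologicalSpace Y] [FunLike F X (StrongDual 𝕜 Y)]
  [LinearMapClass F 𝕜 X (StrongDual 𝕜 Y)] (φ : F) {t : TopologicalSpace X}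
  (ht : t ≤ sigmaTopology φ)

/-- The transpose of `φ : X → Y'`, with values in the dual of `X` with the topology `t`. -/
def transposeWithTopology : Y →ₗ[𝕜] StrongDual 𝕜 (WithTopology X t) :=
  continuousTranspose ((φ : X →ₗ[𝕜] StrongDual 𝕜 Y) ∘ₗ (toTopologyLinearEquiv 𝕜 t).symm.toLinearMap)
    fun y => (continuous_le_dom ht (continuous_sigmaTopology_apply φ y)).comp
      (WithTopology.continuous_ofTopology t)

end

variable [UniformSpace Y] [IsUniformAddGroup Y] [ContinuousSMul 𝕜 Y] [LocallyConvexSpace 𝕜 Y]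
  [FunLike F X (StrongDual 𝕜 Y)] [LinearMapClass F 𝕜 X (StrongDual 𝕜 Y)] {φ : F}
  {t : TopologicalSpace X}

theorem surjective_transposeWithTopology [CompleteSpace Y] (hφ : Function.Surjective φ)
    (ht : t ≤ sigmaTopology φ)
    (hco : ∀ p : Seminorm 𝕜 Y, Continuous p → t.induced (Subtype.val : dualBall φ p → X) =
      (sigmaTopology φ).induced Subtype.val) :
    Function.Surjective (transposeWithTopology φ ht) := fun f => by
  obtain ⟨y, hy⟩ := exists_eq_apply_of_continuous hφ hco
    (f := (f : WithTopology X t →ₗ[𝕜] 𝕜) ∘ₗ (toTopologyLinearEquiv 𝕜 t).toLinearMap)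
    (f.continuous.comp (WithTopology.continuous_toTopology t))
  exact ⟨y, ContinuousLinearMap.ext fun x => (hy x.ofTopology).symm⟩

theorem injective_transposeWithTopology [T2Space Y] (hφ : Function.Surjective φ)
    (ht : t ≤ sigmaTopology φ) : Function.Injective (transposeWithTopology φ ht) := fun _ _ h =>
  eq_of_forall_apply_eq hφ fun x => DFunLike.congr_fun h (WithTopology.toTopology t x)

theorem surjective_transposeWithTopology_compactTopology [CompleteSpace Y]
    (hφ : Function.Surjective φ) :
    Function.Surjective (transposeWithTopology φ (compactTopology_le_sigmaTopology φ)) :=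
  surjective_transposeWithTopology hφ _ fun _ hp =>
    induced_compactTopology_eq_of_subset_dualBall φ hp subset_rfl

theorem tfae_dual [CompleteSpace Y] [T2Space Y] (hφ : Function.Surjective φ) (x' : X → 𝕜) :
    List.TFAE [
    ∃ f : StrongDual 𝕜 (WithTopology X (compactTopology φ)),
      ∀ x, f (WithTopology.toTopology _ x) = x' x,
    ∃ f : StrongDual 𝕜 (WithTopology X (sigmaTopology φ)),
      ∀ x, f (WithTopology.toTopology _ x) = x' x,
    ∃ y : Y, ∀ x, x' x = φ x y,
    ∃! y : Y, ∀ x, x' x = φ x y] := by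
  have h : ∀ {t : TopologicalSpace X} (ht : t ≤ sigmaTopology φ),
      Function.Surjective (transposeWithTopology φ ht) →
        ((∃ f : StrongDual 𝕜 (WithTopology X t), ∀ x, f (WithTopology.toTopology t x) = x' x) ↔
          ∃ y : Y, ∀ x, x' x = φ x y) := fun ht hsurj =>
    hsurj.exists.trans (exists_congr fun y => forall_congr' fun x => eq_comm)
  tfae_have 1 ↔ 3 := h _ (surjective_transposeWithTopology_compactTopology hφ)
  tfae_have 2 ↔ 3 :=
    h le_rfl (surjective_transposeWithTopology hφ le_rfl fun _ _ => rfl)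
  tfae_have 3 → 4 := fun ⟨y, hy⟩ =>
    ⟨y, hy, fun z hz => eq_of_forall_apply_eq hφ fun x => (hz x).symm.trans (hy x)⟩
  tfae_have 4 → 3 := ExistsUnique.exists
  tfae_finish

end TransposeWithTopology

section BddContDual

variable {𝕜 X : Type*} [RCLike 𝕜] [AddCommGroup X] [Module 𝕜 X] {τ τ' γ : TopologicalSpace X}

/-- The inclusion of the dual of `X` with the topology `γ` into the space of functionals that are
`τ'`-continuous on `τ`-bounded sets. -/
def toBddContDual (h : CoincideOnBdd 𝕜 τ τ' γ) :
    StrongDual 𝕜 (WithTopology X γ) →ₗ[𝕜] bddContDual 𝕜 τ τ' :=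
  ((toTopologyLinearEquiv 𝕜 γ).toLinearMap.dualMap ∘ₗ ContinuousLinearMap.coeLM 𝕜).codRestrict _
    fun f B hB => continuousOn_of_induced_eq (h B hB)
      (f.continuous.comp (WithTopology.continuous_toTopology γ)).continuousOn

theorem injective_toBddContDual (h : CoincideOnBdd 𝕜 τ τ' γ) :
    Function.Injective (toBddContDual h) := fun _ _ hfg =>
  ContinuousLinearMap.ext fun x => DFunLike.congr_fun (congrArg Subtype.val hfg) x.ofTopology

theorem isInducing_toBddContDual (h : CoincideOnBdd 𝕜 τ τ' γ) (hbdd : SameBdd 𝕜 τ γ) :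
    IsInducing (toBddContDual h) := by
  have hval : IsInducing fun f : bddContDual 𝕜 τ τ' =>
      UniformOnFun.ofFun {B | IsBddFor 𝕜 τ B} (f : Module.Dual 𝕜 X) := ⟨rfl⟩
  have hiff : ∀ B : Set (WithTopology X γ),
      IsVonNBounded 𝕜 B ↔ IsBddFor 𝕜 τ (WithTopology.toTopology γ ⁻¹' B) := fun B =>
    isVonNBounded_withTopology_iff.trans (hbdd _).symm
  let e : UniformOnFun (WithTopology X γ) 𝕜 {B | IsVonNBounded 𝕜 B} ≃ᵤ
      UniformOnFun X 𝕜 {B | IsBddFor 𝕜 τ B} :=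
    UniformOnFun.congrLeft (WithTopology.equiv X γ)
      (fun B hB => by
        have hB' := (hiff B).1 hB
        rwa [← WithTopology.image_ofTopology] at hB')
      fun _ hB => (hiff _).2 hB
  rw [← hval.of_comp_iff]
  exact e.isUniformEmbedding.isInducing.comp
    (ContinuousLinearMap.isUniformEmbedding_toUniformOnFun (σ := RingHom.id 𝕜)).isInducing

end BddContDual

section PredualDuality

variable {𝕜 X Y : Type*} [RCLike 𝕜] [AddCommGroup X] [Module 𝕜 X] {τ : TopologicalSpace X}
  [AddCommGroup Y] [Module 𝕜 Y]

/-- `φ` as a topological isomorphism from `(X, τ_{c,φ}(X, Y))` to `(Y', τ_c(Y', Y))`. -/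
def compactTopologyCLE [TopologicalSpace Y] (φ : X ≃L[𝕜] StrongDual 𝕜 Y) :
    WithTopology X (compactTopology φ) ≃L[𝕜] (Y →L_c[𝕜] 𝕜) :=
  continuousLinearEquivOfIsInducing
    (toUniformDual φ {K | IsCompact K} ∘ₗ
      (toTopologyLinearEquiv 𝕜 (compactTopology φ)).symm.toLinearMap)
    (φ.bijective.comp (toTopologyLinearEquiv 𝕜 (compactTopology φ)).symm.bijective)
    ⟨by
      rw [WithTopology.topology_eq_induced, compactTopology, pairingTopology, induced_compose]
      rfl⟩

variable [UniformSpace Y] [IsUniformAddGroup Y] [ContinuousSMul 𝕜 Y] [BarrelledSpace 𝕜 Y]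
  [LocallyConvexSpace 𝕜 Y] (φ : X ≃L[𝕜] StrongDual 𝕜 Y)

theorem isInducing_transposeWithTopology_compactTopology :
    IsInducing (transposeWithTopology φ (compactTopology_le_sigmaTopology φ)) := by
  refine isInducing_continuousTranspose ?_ _ fun B => ?_
  · exact φ.surjective.comp (toTopologyLinearEquiv 𝕜 _).symm.surjective
  · rw [isVonNBounded_withTopology_iff, isBddFor_iff_exists_subset_dualBall φ
      (topology_le_compactTopology φ) (compactTopology_le_sigmaTopology φ)]
    exact exists_congr fun p => and_congr_right'
      ⟨fun h x hx => h (a := x.ofTopology) hx,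
        fun h x hx => h (a := WithTopology.toTopology _ x) hx⟩

variable [CompleteSpace Y]

/-- The topological isomorphism `κ_φ ∘ J_Y` from `Y` to the strong dual of
`(X, τ_{c,φ}(X, Y))`. -/
def evalCompactCLE [T2Space Y] :
    Y ≃L[𝕜] StrongDual 𝕜 (WithTopology X (compactTopology φ)) :=
  continuousLinearEquivOfIsInducing (transposeWithTopology φ (compactTopology_le_sigmaTopology φ))
    ⟨injective_transposeWithTopology φ.surjective _,
      surjective_transposeWithTopology_compactTopology φ.surjective⟩
    (isInducing_transposeWithTopology_compactTopology φ)

theorem surjective_toBddContDual :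
    Function.Surjective (toBddContDual (coincideOnBdd_compactTopology φ)) := fun f => by
  obtain ⟨y, hy⟩ := exists_eq_apply_of_continuousOn_dualBall φ.surjective (f : Module.Dual 𝕜 X)
    fun _ hp => f.2 _ (isBddFor_of_subset_dualBall φ hp subset_rfl)
  exact ⟨transposeWithTopology φ (compactTopology_le_sigmaTopology φ) y,
    Subtype.ext (LinearMap.ext fun x => (hy x).symm)⟩

/-- The identification of the strong dual of `(X, τ_{c,φ}(X, Y))` with the functionals that are
`σ_φ(X, Y)`-continuous on bounded sets. -/
def bddContDualCLE : StrongDual 𝕜 (WithTopology X (compactTopology φ)) ≃L[𝕜]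
    bddContDual 𝕜 τ (sigmaTopology φ) :=
  continuousLinearEquivOfIsInducing (toBddContDual (coincideOnBdd_compactTopology φ))
    ⟨injective_toBddContDual (coincideOnBdd_compactTopology φ), surjective_toBddContDual φ⟩
    (isInducing_toBddContDual (coincideOnBdd_compactTopology φ) (sameBdd_compactTopology φ))

end PredualDuality

end LCDual
end

theorem mainTheorem11 {𝕜 X Y : Type*} [RCLike 𝕜]
    [AddCommGroup X] [Module 𝕜 X] [τ : TopologicalSpace X] [IsTopologicalAddGroup X]
    [ContinuousSMul 𝕜 X] [LocallyConvexSpace 𝕜 X] [T2Space X]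
    [AddCommGroup Y] [Module 𝕜 Y] [UniformSpace Y] [IsUniformAddGroup Y]
    [ContinuousSMul 𝕜 Y] [LocallyConvexSpace 𝕜 Y] [T2Space Y]
    [CompleteSpace Y] [BarrelledSpace 𝕜 Y]
    (φ : X ≃L[𝕜] StrongDual 𝕜 Y) :
    -- (a)
    (BBC 𝕜 τ (sigmaTopology φ) ∧ CNC 𝕜 τ (sigmaTopology φ) ∧
      mixedTopologyOf τ φ = compactTopology φ ∧
      SameBdd 𝕜 τ (mixedTopologyOf τ φ)) ∧
    -- (b)
    (∃ (κ : StrongDual 𝕜 (Y →L_c[𝕜] 𝕜) ≃L[𝕜]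
          StrongDual 𝕜 (WithTopology X (mixedTopologyOf τ φ)))
        (κJ : Y ≃L[𝕜] StrongDual 𝕜 (WithTopology X (mixedTopologyOf τ φ)))
        (I : X ≃L[𝕜] StrongDual 𝕜 (StrongDual 𝕜 (WithTopology X (mixedTopologyOf τ φ)))),
      (∀ y'' x, κ y'' (WithTopology.toTopology _ x) =
        y'' (UniformConvergenceCLM.ofFun (RingHom.id 𝕜) 𝕜 {N | IsCompact N} (φ x))) ∧
      (∀ y, κJ y = κ (evalCompact 𝕜 Y y)) ∧
      (∀ x x', I x x' = x' (WithTopology.toTopology _ x)) ∧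
      ContinuousLinearMap.precomp 𝕜 κJ.toContinuousLinearMap =
        φ.toContinuousLinearMap.comp I.symm.toContinuousLinearMap) ∧
    (∃ e : StrongDual 𝕜 (WithTopology X (mixedTopologyOf τ φ)) ≃L[𝕜]
        bddContDual 𝕜 τ (sigmaTopology φ),
      ∀ x' x, (e x' : Module.Dual 𝕜 X) x = x' (WithTopology.toTopology _ x)) ∧
    -- (c)
    (∀ x' : X → 𝕜, List.TFAE [
      ∃ f : StrongDual 𝕜 (WithTopology X (mixedTopologyOf τ φ)),
        ∀ x, f (WithTopology.toTopology _ x) = x' x,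
      ∃ f : StrongDual 𝕜 (WithTopology X (sigmaTopology φ)),
        ∀ x, f (WithTopology.toTopology _ x) = x' x,
      ∃ y : Y, ∀ x, x' x = φ x y,
      ∃! y : Y, ∀ x, x' x = φ x y]) := by
  rw [mixedTopologyOf_eq_compactTopology φ]
  let κJ := evalCompactCLE φ
  refine ⟨⟨bbc_sigmaTopology φ, cnc_sigmaTopology φ, rfl, sameBdd_compactTopology φ⟩,
    ⟨(compactTopologyCLE φ).symm.arrowCongr (.refl 𝕜 𝕜), κJ,
      φ.trans (κJ.arrowCongr (.refl 𝕜 𝕜)), fun _ _ => rfl, fun _ => rfl, fun x x' => ?_, ?_⟩,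
    ⟨bddContDualCLE φ, fun _ _ => rfl⟩, tfae_dual φ.surjective⟩
  · exact DFunLike.congr_fun (κJ.apply_symm_apply x') (WithTopology.toTopology _ x)
  · ext F y
    simp
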